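/- Let $\mathbb R^5_1$ be $\mathbb R^5$ with the Lorentzian scalar product $\langle x,y\rangle_L=x_1y_1+x_2y_2+x_3y_3+x_4y_4-x_5y_5$, and let $H^4=\{x\in\mathbb R^5_1 : \langle x,x\rangle_L=-1,\ x_5>0\}$ be the hyperbolic space with the induced Riemannian metric. Let $a_1,a_2,b_1,b_2,b_3\in\mathbb C$ satisfy $$a_1^2+b_1^2+b_2^2=0,\qquad a_1a_2=-b_2^2,\qquad a_1b_3=b_1b_2,\qquad a_1b_1b_2\neq 0,$$ and put $$P(x)=a_1(x_1^2-x_2^2)+a_2(x_2^2-x_3^2)+2b_1x_1x_2+2b_2x_1x_3+2b_3x_2x_3,\qquad Q(x)=(x_4-x_5)^2 .$$ Then $Q$ has no zero on $H^4$, and the globally defined function $\Phi^*=P/Q:H^4\to\mathbb C$ is a harmonic morphism: it is smooth, and for every open $U\subseteq\mathbb C$ and every harmonic $f:U\to\mathbb R$ the composition $f\circ\Phi^*$ is harmonic (with respect to the Laplace–Beltrami operator of $H^4$) on $(\Phi^*)^{-1}(U)$. Moreover, for every non-zero $\alpha$ in the image of $\Phi^*$ the fibre $$(\Phi^*)^{-1}(\{\alpha\})=\{x\in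 H^4 : P(x)=\alpha\,Q(x)\}$$ is a complete minimal surface in $H^4$, that is, a smooth embedded (not necessarily connected) two-dimensional submanifold of $H^4$ with vanishing mean curvature vector that is geodesically complete in the induced metric. -/

import Mathlib

open scoped ContDiff

noncomputable section

/-- The vector space underlying the Minkowski space `ℝ⁵₁`; the coordinates `x₁, …, x₅` are
`x 0, …, x 4`. -/
abbrev R51 : Type := Fin 5 → ℝ

/-- The Lorentzian scalar product of `ℝ⁵₁`; the last coordinate is the timelike one. -/
def lor (x y : R51) : ℝ :=
  x 0 * y 0 + x 1 * y 1 + x 2 * y 2 + x 3 * y 3 - x 4 * y 4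

/-- The hyperbolic space `H⁴`: the upper sheet of the hyperboloid `⟨x, x⟩ = -1`. -/
def H4 : Set R51 := {x | lor x x = -1 ∧ 0 < x 4}

/-! ### Tangent vectors and geodesics of submanifolds of `ℝ⁵₁` -/

/-- The tangent vectors of `S` at `p`: velocities of smooth curves in `S` through `p`. -/
def tangentVectors (S : Set R51) (p : R51) : Set R51 :=
  {v | ∃ c : ℝ → R51, ContDiff ℝ ∞ c ∧ c 0 = p ∧ (∀ᶠ t in nhds 0, c t ∈ S) ∧ deriv c 0 = v}

/-- A geodesic `ℝ → S` for the metric induced on `S` by the Lorentzian scalar product: a smooth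
curve in `S` whose covariant acceleration, i.e. the tangential part of its acceleration in `ℝ⁵₁`,
vanishes. -/
structure IsGeodesic (S : Set R51) (γ : ℝ → R51) : Prop where
  smooth : ContDiff ℝ ∞ γ
  mem : ∀ t, γ t ∈ S
  acceleration : ∀ t, ∀ w ∈ tangentVectors S (γ t), lor (deriv (deriv γ) t) w = 0

/-- (Geodesic) completeness: through every point and in every tangent direction there is a
geodesic that is defined on all of `ℝ`. -/
def IsCompleteSubmanifold (S : Set R51) : Prop :=
  ∀ p ∈ S, ∀ v ∈ tangentVectors S p, ∃ γ : ℝ → R51, IsGeodesic S γ ∧ γ 0 = p ∧ deriv γ 0 = v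

/-- The hyperboloid has its usual geodesics in the sense above; in particular there are geodesics
`ℝ → H⁴` with any given unit tangent vector as initial velocity. -/
theorem isGeodesic_H4 {p v : R51} (hp : p ∈ H4) (hpv : lor p v = 0) (hv : lor v v = 1) :
    IsGeodesic H4 (fun t => Real.cosh t • p + Real.sinh t • v) ∧
      deriv (fun t => Real.cosh t • p + Real.sinh t • v) 0 = v := by
  have d1 : ∀ (a b : R51) (t : ℝ), HasDerivAt (fun t => Real.cosh t • a + Real.sinh t • b)
      (Real.cosh t • b + Real.sinh t • a) t := by
    intro a b t
    have := ((Real.hasDerivAt_cosh t).smul_const a).add ((Real.hasDerivAt_sinh t).smul_const b)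
    rw [add_comm (Real.sinh t • a)] at this
    exact this
  have d1' : ∀ a b : R51, deriv (fun t => Real.cosh t • a + Real.sinh t • b) =
      fun t => Real.cosh t • b + Real.sinh t • a := fun a b => funext fun t => (d1 a b t).deriv
  have key : ∀ (c : ℝ → R51), ContDiff ℝ ∞ c → (∀ᶠ t in nhds 0, c t ∈ H4) →
      lor (c 0) (deriv c 0) = 0 := by
    intro c hc hmem
    have hd : ∀ k, HasDerivAt (fun t => c t k) (deriv c 0 k) 0 :=
      hasDerivAt_pi.1 (hc.differentiable (by simp) 0).hasDerivAt
    have h := (((((hd 0).mul (hd 0)).add ((hd 1).mul (hd 1))).add ((hd 2).mul (hd 2))).add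
      ((hd 3).mul (hd 3))).sub ((hd 4).mul (hd 4))
    have h0 := h.unique ((hasDerivAt_const (0 : ℝ) (-1 : ℝ)).congr_of_eventuallyEq
      (hmem.mono fun t ht => ht.1))
    simp only [lor]
    linarith
  refine ⟨⟨?_, ?_, ?_⟩, ?_⟩
  · exact (Real.contDiff_cosh.smul contDiff_const).add (Real.contDiff_sinh.smul contDiff_const)
  · intro t
    obtain ⟨hp1, hp4⟩ := hp
    have hcs := Real.cosh_sq t
    have hc := Real.cosh_pos t
    simp only [lor] at hp1 hpv hv
    constructor
    · simp only [lor, Pi.add_apply, Pi.smul_apply, smul_eq_mul]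
      linear_combination Real.cosh t ^ 2 * hp1 + 2 * Real.cosh t * Real.sinh t * hpv
        + Real.sinh t ^ 2 * hv - hcs
    · simp only [Pi.add_apply, Pi.smul_apply, smul_eq_mul]
      have hlt : v 4 ^ 2 < p 4 ^ 2 := by
        have l : (p 4 * v 4) ^ 2 ≤ (p 4 ^ 2 - 1) * (1 + v 4 ^ 2) := by
          have e1 : p 4 * v 4 = p 0 * v 0 + p 1 * v 1 + p 2 * v 2 + p 3 * v 3 := by linarith
          have e2 : p 4 ^ 2 - 1 = p 0 ^ 2 + p 1 ^ 2 + p 2 ^ 2 + p 3 ^ 2 := by nlinarith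
          have e3 : 1 + v 4 ^ 2 = v 0 ^ 2 + v 1 ^ 2 + v 2 ^ 2 + v 3 ^ 2 := by nlinarith
          rw [e1, e2, e3]
          nlinarith [sq_nonneg (p 0 * v 1 - p 1 * v 0), sq_nonneg (p 0 * v 2 - p 2 * v 0),
            sq_nonneg (p 0 * v 3 - p 3 * v 0), sq_nonneg (p 1 * v 2 - p 2 * v 1),
            sq_nonneg (p 1 * v 3 - p 3 * v 1), sq_nonneg (p 2 * v 3 - p 3 * v 2)]
        nlinarith
      have habs : |Real.sinh t * v 4| < Real.cosh t * p 4 := by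
        refine abs_lt_of_sq_lt_sq ?_ (by positivity)
        rw [mul_pow, mul_pow, hcs]
        nlinarith [sq_nonneg (Real.sinh t), mul_nonneg (sq_nonneg (Real.sinh t)) (sub_nonneg.2 hlt.le),
          sq_pos_of_pos hp4]
      have := (abs_lt.1 habs).1
      linarith
  · rintro t w ⟨c, hc, hc0, hmem, rfl⟩
    have := key c hc hmem
    rw [hc0] at this
    rw [d1', d1']
    exact this
  · rw [d1']
    simp

/-! ### Harmonic functions and harmonic morphisms on `H⁴` -/

/-- `f` is harmonic on the (relatively open) subset `W` of `H⁴`: it is `C²` there and its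
Laplace-Beltrami operator vanishes. The latter is the trace of the Hessian, and
`Hess f (v, v) = (f ∘ γ)''(0)` for the geodesic `γ` of `H⁴` with initial velocity `v`; the trace
is taken over orthonormal bases of the tangent space of `H⁴`. -/
def IsHarmonicOnH4 (f : R51 → ℝ) (W : Set R51) : Prop :=
  ContDiffOn ℝ 2 f W ∧
    ∀ p ∈ W, ∀ γ : Fin 4 → ℝ → R51,
      (∀ i, IsGeodesic H4 (γ i) ∧ γ i 0 = p) →
      (∀ i j, lor (deriv (γ i) 0) (deriv (γ j) 0) = if i = j then 1 else 0) →
      ∑ i, deriv (deriv (fun t => f (γ i t))) 0 = 0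

/-- `Φ : H⁴ → ℂ` is a harmonic morphism: it is smooth and pulls harmonic functions on open subsets
of `ℂ` back to harmonic functions. -/
def IsHarmonicMorphismH4 (Φ : R51 → ℂ) : Prop :=
  ContDiffOn ℝ ∞ Φ H4 ∧
    ∀ (U : Set ℂ) (f : ℂ → ℝ), IsOpen U → InnerProductSpace.HarmonicOnNhd f U →
      IsHarmonicOnH4 (fun x => f (Φ x)) {x ∈ H4 | Φ x ∈ U}

/-! ### Minimal surfaces in `H⁴` -/

/-- The partial derivative `∂ᵢψ`. -/
def pd (ψ : (Fin 2 → ℝ) → R51) (i : Fin 2) (u : Fin 2 → ℝ) : R51 :=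
  fderiv ℝ ψ u (Pi.single i 1)

/-- `ψ`, restricted to `D`, is a smooth local parametrization of the surface `S`. -/
structure IsLocalParam (S : Set R51) (D : Set (Fin 2 → ℝ)) (ψ : (Fin 2 → ℝ) → R51) : Prop where
  isOpen : IsOpen D
  smooth : ContDiffOn ℝ ∞ ψ D
  immersion : ∀ u ∈ D, Function.Injective (fderiv ℝ ψ u)
  embedding : Topology.IsEmbedding (D.domRestrict ψ)
  image : ∃ V : Set R51, IsOpen V ∧ ψ '' D = S ∩ V

/-- `S` is a smooth embedded two-dimensional submanifold. -/
def IsEmbeddedSurface (S : Set R51) : Prop :=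
  ∀ p ∈ S, ∃ D ψ, IsLocalParam S D ψ ∧ p ∈ ψ '' D

/-- The matrix of the first fundamental form. -/
def firstFundamentalForm (ψ : (Fin 2 → ℝ) → R51) (u : Fin 2 → ℝ) : Matrix (Fin 2) (Fin 2) ℝ :=
  Matrix.of fun i j => lor (pd ψ i u) (pd ψ j u)

/-- The mean curvature vector in `H⁴` of the parametrized surface `ψ` vanishes at `u`: the trace
`∑ gⁱʲ ⟨∂ᵢ∂ⱼψ, ν⟩` of the second fundamental form is zero for every `ν` that is tangent to `H⁴`
(orthogonal to `ψ u`) and normal to the surface. -/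
def MeanCurvatureVanishesAt (ψ : (Fin 2 → ℝ) → R51) (u : Fin 2 → ℝ) : Prop :=
  ∀ ν : R51, lor (ψ u) ν = 0 → (∀ k, lor (pd ψ k u) ν = 0) →
    ∑ i, ∑ j, (firstFundamentalForm ψ u)⁻¹ i j * lor (pd (pd ψ j) i u) ν = 0

/-- `S` is a minimal surface in `H⁴`: an embedded surface whose mean curvature vector vanishes.
It need not be connected. -/
structure IsMinimalSurfaceH4 (S : Set R51) : Prop where
  nonempty : S.Nonempty
  subset : S ⊆ H4
  embedded : IsEmbeddedSurface S
  minimal : ∀ D ψ, IsLocalParam S D ψ → ∀ u ∈ D, MeanCurvatureVanishesAt ψ u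

/-! ### The functions `P` and `Q` -/

/-- The quadratic form with symmetric matrix
`!![a₁, b₁, b₂; b₁, a₂ - a₁, b₃; b₂, b₃, -a₂]` in `x₁, x₂, x₃`. -/
def quadP (a₁ a₂ b₁ b₂ b₃ : ℂ) (x : R51) : ℂ :=
  a₁ * ((x 0 : ℂ) ^ 2 - (x 1 : ℂ) ^ 2) + a₂ * ((x 1 : ℂ) ^ 2 - (x 2 : ℂ) ^ 2)
    + 2 * b₁ * ((x 0 : ℂ) * (x 1 : ℂ)) + 2 * b₂ * ((x 0 : ℂ) * (x 2 : ℂ))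
    + 2 * b₃ * ((x 1 : ℂ) * (x 2 : ℂ))

/-- `Q = (x₄ - x₅)²`. -/
def quadQ (x : R51) : ℂ := ((x 3 : ℂ) - (x 4 : ℂ)) ^ 2

end

/-! ### The Lorentzian scalar product -/

/-! Put `L = a₁x₁ + b₁x₂ + b₂x₃` and `m = x₅ - x₄`. The conditions on the coefficients say that `ξ =
(a₁, b₁, b₂)` is isotropic and that `a₁P = L²`; since `Q = m²`, `Φ* = (L/m)²/a₁`. On `H⁴` one has `m
> 0`, so the quotient is smooth. Harmonicity: along a unit speed geodesic `γ'' = γ`, so every linear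
form satisfies `ℓ'' = ℓ`. Over an orthonormal frame `vᵢ` at `p`, `∑ ℓ(vᵢ)k(vᵢ) = ℓ(p)k(p) + ⟨ℓ,k⟩`,
where the last term is the dual Lorentzian product (`sum_frame_mul`). It vanishes for all pairs from
`L, m`, which makes both the Laplacian and the complex square of the gradient of `(L/m)²` zero; the
chain rule then gives the harmonic morphism property (`isHarmonicMorphismH4_sq_div`). Fibres: if `c²
= a₁α`, the equation `P = αQ` factors as `(L - cm)(L + cm) = 0`. For `α ≠ 0` the two factors have no
common zero on `H⁴`, so the fibre is the disjoint union of two sheets, each cut out of `H⁴` by a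
linear subspace of dimension 3. Such a sheet is totally geodesic, hence minimal
(`meanCurvatureVanishesAt_of_linForm_eq_zero`), and contains the geodesics `cosh t • p + sinh t • v`
tangent to it, hence is complete. -/

theorem lor_comm (x y : R51) : lor x y = lor y x := by
  simp only [lor]; ring

theorem lor_add_left (x y z : R51) : lor (x + y) z = lor x z + lor y z := by
  simp only [lor, Pi.add_apply]; ring

theorem lor_add_right (x y z : R51) : lor x (y + z) = lor x y + lor x z := by
  simp only [lor, Pi.add_apply]; ring

theorem lor_smul_left (r : ℝ) (x y : R51) : lor (r • x) y = r * lor x y := by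
  simp only [lor, Pi.smul_apply, smul_eq_mul]; ring

theorem lor_smul_right (r : ℝ) (x y : R51) : lor x (r • y) = r * lor x y := by
  simp only [lor, Pi.smul_apply, smul_eq_mul]; ring

theorem lor_zero_left (x : R51) : lor 0 x = 0 := by simp [lor]

theorem HasDerivAt.lor {x y : ℝ → R51} {x' y' : R51} {t : ℝ} (hx : HasDerivAt x x' t)
    (hy : HasDerivAt y y' t) :
    HasDerivAt (fun t => lor (x t) (y t)) (lor x' (y t) + lor (x t) y') t := by
  have hx := hasDerivAt_pi.1 hx
  have hy := hasDerivAt_pi.1 hy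
  have h := (((((hx 0).mul (hy 0)).add ((hx 1).mul (hy 1))).add ((hx 2).mul (hy 2))).add
    ((hx 3).mul (hy 3))).sub ((hx 4).mul (hy 4))
  refine h.congr_deriv ?_
  simp only [_root_.lor]
  ring

/-- The scalar product is positive definite on the tangent spaces of `H⁴`. -/
theorem lor_self_pos {p v : R51} (hp : p ∈ H4) (hpv : lor p v = 0) (hv : v ≠ 0) :
    0 < lor v v := by
  obtain ⟨hp1, hp4⟩ := hp
  by_contra! hle
  simp only [lor] at hp1 hpv hle
  have e1 : p 4 * v 4 = p 0 * v 0 + p 1 * v 1 + p 2 * v 2 + p 3 * v 3 := by linarith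
  -- Cauchy–Schwarz in the spatial coordinates: if `⟨v,v⟩ ≤ 0`, then `p₅²v₅² ≤ (p₅² - 1)v₅²`, which
  -- forces `v₅ = 0` and then `v = 0`.
  have l : (p 4 * v 4) ^ 2 ≤ (p 0 ^ 2 + p 1 ^ 2 + p 2 ^ 2 + p 3 ^ 2) *
      (v 0 ^ 2 + v 1 ^ 2 + v 2 ^ 2 + v 3 ^ 2) := by
    rw [e1]
    nlinarith [sq_nonneg (p 0 * v 1 - p 1 * v 0), sq_nonneg (p 0 * v 2 - p 2 * v 0),
      sq_nonneg (p 0 * v 3 - p 3 * v 0), sq_nonneg (p 1 * v 2 - p 2 * v 1),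
      sq_nonneg (p 1 * v 3 - p 3 * v 1), sq_nonneg (p 2 * v 3 - p 3 * v 2)]
  have e2 : p 0 ^ 2 + p 1 ^ 2 + p 2 ^ 2 + p 3 ^ 2 = p 4 ^ 2 - 1 := by linarith
  have hle' : v 0 ^ 2 + v 1 ^ 2 + v 2 ^ 2 + v 3 ^ 2 ≤ v 4 ^ 2 := by linarith
  have l2 := mul_le_mul_of_nonneg_left hle'
    (show 0 ≤ p 0 ^ 2 + p 1 ^ 2 + p 2 ^ 2 + p 3 ^ 2 by positivity)
  rw [e2] at l l2
  have h4 : v 4 ^ 2 ≤ 0 := by linarith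
  have zero : ∀ r : ℝ, r ^ 2 ≤ 0 → r = 0 := fun r hr =>
    (pow_eq_zero_iff two_ne_zero).1 (le_antisymm hr (sq_nonneg r))
  have n0 := sq_nonneg (v 0)
  have n1 := sq_nonneg (v 1)
  have n2 := sq_nonneg (v 2)
  have n3 := sq_nonneg (v 3)
  refine hv (funext fun k => zero _ ?_)
  fin_cases k
  · change v 0 ^ 2 ≤ 0; linarith
  · change v 1 ^ 2 ≤ 0; linarith
  · change v 2 ^ 2 ≤ 0; linarith
  · change v 3 ^ 2 ≤ 0; linarith
  · exact h4

theorem lor_deriv_eq_zero {c : ℝ → R51} {t : ℝ} (hc : DifferentiableAt ℝ c t)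
    (hmem : ∀ᶠ s in nhds t, c s ∈ H4) : lor (c t) (deriv c t) = 0 := by
  have h := (hc.hasDerivAt.lor hc.hasDerivAt).unique
    ((hasDerivAt_const t (-1 : ℝ)).congr_of_eventuallyEq (hmem.mono fun t ht => ht.1))
  rw [lor_comm (deriv c t)] at h
  linarith

/-- A vector orthogonal to all tangent vectors of `H⁴` at `p` is a multiple of `p`. -/
theorem eq_smul_of_orthogonal_tangentVectors {p a : R51} (hp : p ∈ H4)
    (h : ∀ w ∈ tangentVectors H4 p, lor a w = 0) : a = (-lor a p) • p := by
  have hpw : lor p (a + lor a p • p) = 0 := by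
    rw [lor_add_right, lor_smul_right, hp.1, lor_comm p a]; ring
  by_contra hne
  have hw : a + lor a p • p ≠ 0 := fun h0 => hne (by
    rw [neg_smul]; exact eq_neg_of_add_eq_zero_left h0)
  -- `w` is the tangential part of `a`. Its normalization is the velocity of a geodesic, so `⟨a,w⟩ =
  -- 0`; but `⟨w,w⟩ = ⟨a,w⟩`.
  set w := a + lor a p • p with hwdef
  have hpos := lor_self_pos hp hpw hw
  have hs : √(lor w w) ≠ 0 := (Real.sqrt_pos.2 hpos).ne'
  obtain ⟨hg, hd⟩ := isGeodesic_H4 hp (v := (√(lor w w))⁻¹ • w)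
    (by rw [lor_smul_right, hpw, mul_zero])
    (by
      rw [lor_smul_right, lor_smul_left]
      field_simp
      exact (Real.sq_sqrt hpos.le).symm)
  have := h _ ⟨_, hg.smooth, by simp, Filter.Eventually.of_forall hg.mem, hd⟩
  rw [lor_smul_right] at this
  have h0 : lor a w = 0 := by simpa [hs] using this
  have : lor w w = lor a w + lor a p * lor p w := by
    conv_lhs => rw [hwdef]
    rw [lor_add_left, lor_smul_left]
  rw [h0, hpw] at this
  linarith

/-- The acceleration is normal to `H⁴`, hence a multiple of the position; differentiating `⟨γ,γ'⟩ =
0` determines the factor. -/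
theorem IsGeodesic.deriv_deriv_eq {γ : ℝ → R51} (hγ : IsGeodesic H4 γ) (t : ℝ) :
    deriv (deriv γ) t = lor (deriv γ t) (deriv γ t) • γ t := by
  have hd : ∀ t, HasDerivAt γ (deriv γ t) t := fun t =>
    (hγ.smooth.differentiable (by simp) t).hasDerivAt
  have hdd : HasDerivAt (deriv γ) (deriv (deriv γ) t) t :=
    ((contDiff_infty_iff_deriv.1 hγ.smooth).2.differentiable (by simp) t).hasDerivAt
  have h0 : ∀ t, lor (γ t) (deriv γ t) = 0 := fun t =>
    lor_deriv_eq_zero (hd t).differentiableAt (Filter.Eventually.of_forall hγ.mem)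
  have h1 := ((hd t).lor hdd).unique
    ((hasDerivAt_const t (0 : ℝ)).congr_of_eventuallyEq (Filter.Eventually.of_forall h0))
  have h2 := eq_smul_of_orthogonal_tangentVectors (hγ.mem t) (hγ.acceleration t)
  rw [h2]
  congr 1
  rw [lor_comm]
  linarith

/-- Completeness relation for an orthonormal basis of the tangent space of `H⁴` at `p`. -/
theorem sum_frame_mul {p : R51} {v : Fin 4 → R51} (hp : lor p p = -1) (hpv : ∀ i, lor p (v i) = 0)
    (hv : ∀ i j, lor (v i) (v j) = if i = j then 1 else 0) (k l : Fin 5) :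
    ∑ i, v i k * v i l =
      p k * p l + Matrix.diagonal (![1, 1, 1, 1, -1] : Fin 5 → ℝ) k l := by
  set N : Matrix (Fin 5) (Fin 5) ℝ := Matrix.diagonal ![1, 1, 1, 1, -1] with hN
  set N' : Matrix (Fin 5) (Fin 5) ℝ := Matrix.diagonal (Fin.cons (-1) fun _ => 1) with hN'
  set M : Matrix (Fin 5) (Fin 5) ℝ := Matrix.of (Fin.cons p v) with hM
  have hNN : N * N = 1 := by
    rw [hN, Matrix.diagonal_mul_diagonal, ← Matrix.diagonal_one]
    congr 1; funext i; fin_cases i <;> simp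
  have hNN' : N' * N' = 1 := by
    rw [hN', Matrix.diagonal_mul_diagonal, ← Matrix.diagonal_one]
    congr 1; funext i; refine Fin.cases ?_ (fun j => ?_) i <;> simp
  have hlor : ∀ i j, (M * N * M.transpose) i j = lor (M i) (M j) := by
    intro i j
    rw [Matrix.mul_apply]
    simp only [hN, Matrix.mul_diagonal, Matrix.transpose_apply, Fin.sum_univ_five, lor]
    simp
    ring
  -- The rows `p, v₀, …, v₃` of `M` are Lorentz-orthonormal, with the timelike vector first. Turning
  -- this row relation into the column relation `MᵀN'M = N` gives the claim.
  have h1 : M * N * M.transpose = N' := by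
    ext i j
    rw [hlor]
    refine Fin.cases ?_ (fun i => ?_) i <;> refine Fin.cases ?_ (fun j => ?_) j
    · simpa [hM, hN'] using! hp
    · simpa [hM, hN', Matrix.diagonal_apply, (Fin.succ_ne_zero _).symm] using! hpv j
    · rw [lor_comm]
      simpa [hM, hN', Matrix.diagonal_apply, Fin.succ_ne_zero] using! hpv i
    · simpa [hM, hN', Matrix.diagonal_apply] using! hv i j
  have h2 : M * (N * M.transpose * N') = 1 := by
    rw [← Matrix.mul_assoc, ← Matrix.mul_assoc, h1, hNN']
  have h3 := mul_eq_one_comm.1 h2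
  have h4 : M.transpose * N' * M = N := by
    calc M.transpose * N' * M = N * N * (M.transpose * N' * M) := by rw [hNN, Matrix.one_mul]
      _ = N * (N * M.transpose * N' * M) := by simp only [Matrix.mul_assoc]
      _ = N := by rw [h3, Matrix.mul_one]
  rw [← h4, Matrix.mul_apply]
  simp only [hN', hM, Matrix.mul_diagonal, Matrix.transpose_apply, Fin.sum_univ_succ,
    Matrix.of_apply, Fin.cons_zero, Fin.cons_succ]
  ring

/-! ### Second derivatives of compositions with harmonic functions -/

theorem deriv_deriv_comp {f : ℂ → ℝ} {φ φ' : ℝ → ℂ} {φ'' : ℂ} {t : ℝ}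
    (hf : ContDiffAt ℝ 2 f (φ t)) (hφ : ∀ s, HasDerivAt φ (φ' s) s)
    (hφ' : HasDerivAt φ' φ'' t) :
    deriv (deriv fun s => f (φ s)) t =
      fderiv ℝ (fderiv ℝ f) (φ t) (φ' t) (φ' t) + fderiv ℝ f (φ t) φ'' := by
  have hev : ∀ᶠ s in nhds t, ContDiffAt ℝ 2 f (φ s) :=
    (hφ t).continuousAt.eventually (hf.eventually (by simp))
  have h1 : (deriv fun s => f (φ s)) =ᶠ[nhds t] fun s => fderiv ℝ f (φ s) (φ' s) := by
    filter_upwards [hev] with s hs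
    exact ((hs.differentiableAt (by simp)).hasFDerivAt.comp_hasDerivAt s (hφ s)).deriv
  rw [h1.deriv_eq]
  have h2 : HasFDerivAt (fderiv ℝ f) (fderiv ℝ (fderiv ℝ f) (φ t)) (φ t) :=
    ((hf.fderiv_right (m := 1) (by norm_num)).differentiableAt (by simp)).hasFDerivAt
  exact ((h2.comp_hasDerivAt t (hφ t)).clm_apply hφ').deriv

/-- The Hessian of a harmonic function is symmetric and trace-free, so its value at `(w, w)` is a
real linear function of `w²`. -/
theorem sum_hessian_eq_zero {f : ℂ → ℝ} {z : ℂ} (hf : InnerProductSpace.HarmonicAt f z)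
    {ι : Type*} [Fintype ι] (w : ι → ℂ) (hw : ∑ i, w i ^ 2 = 0) :
    ∑ i, fderiv ℝ (fderiv ℝ f) z (w i) (w i) = 0 := by
  set B := fderiv ℝ (fderiv ℝ f) z with hB
  have hsymm : B Complex.I 1 = B 1 Complex.I := (hf.1.isSymmSndFDerivAt (by simp)).eq _ _
  have hlap : B 1 1 + B Complex.I Complex.I = 0 := by
    have := hf.2.self_of_nhds
    rw [InnerProductSpace.laplacian_eq_iteratedFDeriv_complexPlane] at this
    simpa [iteratedFDeriv_two_apply] using this
  have hexp : ∀ w : ℂ, B w w = (w ^ 2).re * B 1 1 + (w ^ 2).im * B 1 Complex.I := by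
    intro w
    have hw : w = w.re • (1 : ℂ) + w.im • Complex.I := by
      simp [Complex.re_add_im]
    conv_lhs => rw [hw]
    simp only [map_add, map_smul, add_apply, smul_apply,
      smul_eq_mul, hsymm]
    simp only [sq, Complex.mul_re, Complex.mul_im]
    linear_combination w.im * w.im * hlap
  rw [Finset.sum_congr rfl fun i _ => hexp (w i), Finset.sum_add_distrib, ← Finset.sum_mul,
    ← Finset.sum_mul, ← Complex.re_sum, ← Complex.im_sum, hw]
  simp

/-! ### The harmonic morphism -/

/-- The function `x₅ - x₄`, which is positive on `H⁴`. -/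
def horo (x : R51) : ℝ := x 4 - x 3

/-- On `H⁴`, `(x₅ - x₄)(x₅ + x₄) = 1 + x₁² + x₂² + x₃² > 0`. -/
theorem horo_pos {x : R51} (hx : x ∈ H4) : 0 < horo x := by
  obtain ⟨h, h4⟩ := hx
  simp only [lor] at h
  simp only [horo]
  by_contra! hle
  nlinarith [mul_self_nonneg (x 0), mul_self_nonneg (x 1), mul_self_nonneg (x 2)]

theorem quadQ_eq_horo_sq (x : R51) : quadQ x = (horo x : ℂ) ^ 2 := by
  simp only [quadQ, horo]; push_cast; ring

theorem quadQ_ne_zero {x : R51} (hx : x ∈ H4) : quadQ x ≠ 0 := by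
  rw [quadQ_eq_horo_sq]
  exact pow_ne_zero _ (Complex.ofReal_ne_zero.2 (horo_pos hx).ne')

/-- The complex linear form `ξ₁x₁ + ξ₂x₂ + ξ₃x₃ - c(x₅ - x₄)`. -/
noncomputable def linForm (ξ₁ ξ₂ ξ₃ c : ℂ) : R51 →L[ℝ] ℂ :=
  LinearMap.toContinuousLinearMap
    { toFun := fun x => ξ₁ * x 0 + ξ₂ * x 1 + ξ₃ * x 2 - c * horo x
      map_add' := fun x y => by simp only [horo, Pi.add_apply]; push_cast; ring
      map_smul' := fun r x => by
        simp only [horo, Pi.smul_apply, smul_eq_mul, Complex.real_smul, RingHom.id_apply]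
        push_cast; ring }

theorem linForm_apply (ξ₁ ξ₂ ξ₃ c : ℂ) (x : R51) :
    linForm ξ₁ ξ₂ ξ₃ c x = ξ₁ * x 0 + ξ₂ * x 1 + ξ₃ * x 2 - c * horo x := rfl

/-- Under the conditions on the coefficients, `P` is up to a factor the square of a linear form. -/
theorem mul_quadP {a₁ a₂ b₁ b₂ b₃ : ℂ} (h₁ : a₁ ^ 2 + b₁ ^ 2 + b₂ ^ 2 = 0)
    (h₂ : a₁ * a₂ = -b₂ ^ 2) (h₃ : a₁ * b₃ = b₁ * b₂) (x : R51) :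
    a₁ * quadP a₁ a₂ b₁ b₂ b₃ x = linForm a₁ b₁ b₂ 0 x ^ 2 := by
  rw [linForm_apply, quadP]
  linear_combination (-(x 1 : ℂ) ^ 2) * h₁ + ((x 1 : ℂ) ^ 2 - (x 2 : ℂ) ^ 2) * h₂
    + 2 * (x 1 : ℂ) * (x 2 : ℂ) * h₃

theorem quadP_div_quadQ {a₁ a₂ b₁ b₂ b₃ : ℂ} (h₁ : a₁ ^ 2 + b₁ ^ 2 + b₂ ^ 2 = 0)
    (h₂ : a₁ * a₂ = -b₂ ^ 2) (h₃ : a₁ * b₃ = b₁ * b₂) (ha : a₁ ≠ 0) (x : R51) :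
    quadP a₁ a₂ b₁ b₂ b₃ x / quadQ x = (linForm a₁ b₁ b₂ 0 x / horo x) ^ 2 / a₁ := by
  rw [div_pow, ← mul_quadP h₁ h₂ h₃, quadQ_eq_horo_sq]
  field_simp

/-- The trace relations expressing that an isotropic linear form and `x₅ - x₄` span a totally
isotropic space. -/
theorem sum_frame_linForm {ξ₁ ξ₂ ξ₃ : ℂ} (hξ : ξ₁ ^ 2 + ξ₂ ^ 2 + ξ₃ ^ 2 = 0) {p : R51}
    {v : Fin 4 → R51} (hp : lor p p = -1) (hpv : ∀ i, lor p (v i) = 0)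
    (hv : ∀ i j, lor (v i) (v j) = if i = j then 1 else 0) :
    ∑ i, linForm ξ₁ ξ₂ ξ₃ 0 (v i) ^ 2 = linForm ξ₁ ξ₂ ξ₃ 0 p ^ 2 ∧
    ∑ i, linForm ξ₁ ξ₂ ξ₃ 0 (v i) * horo (v i) = linForm ξ₁ ξ₂ ξ₃ 0 p * horo p ∧
    ∑ i, (horo (v i) : ℂ) ^ 2 = (horo p : ℂ) ^ 2 := by
  have E : ∀ k l, ∑ i, (v i k : ℂ) * (v i l : ℂ) =
      p k * p l + (Matrix.diagonal (![1, 1, 1, 1, -1] : Fin 5 → ℝ) k l : ℝ) := fun k l => by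
    exact_mod_cast congrArg Complex.ofReal (sum_frame_mul hp hpv hv k l)
  simp only [Fin.sum_univ_four] at E
  have e00 := E 0 0
  have e11 := E 1 1
  have e22 := E 2 2
  have e33 := E 3 3
  have e44 := E 4 4
  have e01 := E 0 1
  have e02 := E 0 2
  have e12 := E 1 2
  have e03 := E 0 3
  have e04 := E 0 4
  have e13 := E 1 3
  have e14 := E 1 4
  have e23 := E 2 3
  have e24 := E 2 4
  have e34 := E 3 4
  clear E
  simp at e00 e11 e22 e33 e44 e01 e02 e12 e03 e04 e13 e14 e23 e24 e34
  simp only [linForm_apply, Fin.sum_univ_four, horo, Complex.ofReal_sub]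
  -- The metric terms of the completeness relation add up to `ξ₁² + ξ₂² + ξ₃² = 0`, to `0`, and to
  -- `1 - 1`, respectively.
  refine ⟨?_, ?_, ?_⟩
  · linear_combination ξ₁ ^ 2 * e00 + ξ₂ ^ 2 * e11 + ξ₃ ^ 2 * e22 + 2 * ξ₁ * ξ₂ * e01
      + 2 * ξ₁ * ξ₃ * e02 + 2 * ξ₂ * ξ₃ * e12 + hξ
  · linear_combination ξ₁ * (e04 - e03) + ξ₂ * (e14 - e13) + ξ₃ * (e24 - e23)
  · linear_combination e33 + e44 - 2 * e34

/-- The square of a quotient of two functions with `l'' = l` and `m'' = m` at `0`. -/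
theorem hasDerivAt_sq_div {l l' m m' : ℝ → ℂ} (a : ℂ) (hl : ∀ t, HasDerivAt l (l' t) t)
    (hl' : HasDerivAt l' (l 0) 0) (hm : ∀ t, HasDerivAt m (m' t) t)
    (hm' : HasDerivAt m' (m 0) 0) (h0 : ∀ t, m t ≠ 0) :
    (∀ t, HasDerivAt (fun t => (l t / m t) ^ 2 / a)
      (2 * (l t / m t) * ((l' t * m t - l t * m' t) / m t ^ 2) / a) t) ∧
    HasDerivAt (fun t => 2 * (l t / m t) * ((l' t * m t - l t * m' t) / m t ^ 2) / a)
      (2 * ((l' 0 * m 0 - l 0 * m' 0) / m 0 ^ 2) ^ 2 / a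
        - 4 * (l 0 / m 0) * (m' 0 * (l' 0 * m 0 - l 0 * m' 0)) / m 0 ^ 3 / a) 0 := by
  have hq : ∀ t, HasDerivAt (fun t => l t / m t) ((l' t * m t - l t * m' t) / m t ^ 2) t :=
    fun t => (hl t).div (hm t) (h0 t)
  constructor
  · intro t
    refine (((hq t).pow 2).div_const a).congr_deriv ?_
    simp
  · have h1 := ((hl'.mul (hm 0)).sub ((hl 0).mul hm')).div ((hm 0).pow 2) (pow_ne_zero 2 (h0 0))
    -- Since `l''m - lm'' = lm - lm = 0`, only the terms with first derivatives survive.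
    refine ((((hq 0).const_mul 2).mul h1).div_const a).congr_deriv ?_
    have := h0 0
    by_cases ha : a = 0
    · simp [ha]
    simp
    field_simp
    ring

/-- With `φᵢ` the function along the `i`-th geodesic, the chain rule gives `∑ Hess f (φᵢ', φᵢ') +
df(∑ φᵢ'')`. The first sum vanishes because `∑ φᵢ'² = 0`, the second because `∑ φᵢ'' = 0`. -/
theorem isHarmonicMorphismH4_sq_div {ξ₁ ξ₂ ξ₃ : ℂ} (hξ : ξ₁ ^ 2 + ξ₂ ^ 2 + ξ₃ ^ 2 = 0) (a : ℂ) :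
    IsHarmonicMorphismH4 fun x => (linForm ξ₁ ξ₂ ξ₃ 0 x / horo x) ^ 2 / a := by
  have hh : ContDiff ℝ ∞ fun x : R51 => (horo x : ℂ) := by
    have : ContDiff ℝ ∞ horo := by unfold horo; fun_prop
    exact Complex.ofRealCLM.contDiff.comp this
  have hsm : ContDiffOn ℝ ∞ (fun x => (linForm ξ₁ ξ₂ ξ₃ 0 x / horo x) ^ 2 / a) H4 := by
    intro x hx
    apply ContDiffAt.contDiffWithinAt
    simp only [div_eq_mul_inv]
    exact (((linForm ξ₁ ξ₂ ξ₃ 0).contDiff.contDiffAt.mul (hh.contDiffAt.inv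
      (Complex.ofReal_ne_zero.2 (horo_pos hx).ne'))).pow 2).mul contDiffAt_const
  refine ⟨hsm, fun U f hU hf => ⟨?_, ?_⟩⟩
  · exact hf.contDiffOn.comp ((contDiffOn_infty.1 hsm 2).mono fun x hx => hx.1) fun x hx => hx.2
  rintro p ⟨hp, hpU⟩ γ hγ hon
  have hγ0 : ∀ i, γ i 0 = p := fun i => (hγ i).2
  have hd : ∀ i t, HasDerivAt (γ i) (deriv (γ i) t) t := fun i t =>
    ((hγ i).1.smooth.differentiable (by simp) t).hasDerivAt
  have hdd : ∀ i, HasDerivAt (deriv (γ i)) (γ i 0) 0 := fun i => by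
    have h := ((contDiff_infty_iff_deriv.1 (hγ i).1.smooth).2.differentiable
      (by simp) 0).hasDerivAt
    rwa [(hγ i).1.deriv_deriv_eq, hon, if_pos rfl, one_smul] at h
  have hpv : ∀ i, lor p (deriv (γ i) 0) = 0 := fun i => by
    rw [← hγ0 i]
    exact lor_deriv_eq_zero (hd i 0).differentiableAt (Filter.Eventually.of_forall (hγ i).1.mem)
  obtain ⟨sLL, sLm, smm⟩ := sum_frame_linForm hξ hp.1 hpv hon
  have hlin : ∀ {c : ℝ → R51} {c' : R51} {t : ℝ}, HasDerivAt c c' t →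
      HasDerivAt (fun t => linForm ξ₁ ξ₂ ξ₃ 0 (c t)) (linForm ξ₁ ξ₂ ξ₃ 0 c') t := fun h =>
    (linForm ξ₁ ξ₂ ξ₃ 0).hasFDerivAt.comp_hasDerivAt _ h
  have hhor : ∀ {c : ℝ → R51} {c' : R51} {t : ℝ}, HasDerivAt c c' t →
      HasDerivAt (fun t => (horo (c t) : ℂ)) (horo c' : ℂ) t := fun h =>
    HasDerivAt.ofReal_comp ((hasDerivAt_pi.1 h 4).sub (hasDerivAt_pi.1 h 3))
  have hne : ∀ i t, (horo (γ i t) : ℂ) ≠ 0 := fun i t =>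
    Complex.ofReal_ne_zero.2 (horo_pos ((hγ i).1.mem t)).ne'
  have hphi := fun i => hasDerivAt_sq_div a (fun t => hlin (hd i t)) (hlin (hdd i))
    (fun t => hhor (hd i t)) (hhor (hdd i)) (hne i)
  have hfp := hf _ hpU
  have key := fun i => deriv_deriv_comp (f := f) (t := 0) (by simpa only [hγ0] using hfp.1)
    (hphi i).1 (hphi i).2
  rw [Finset.sum_congr rfl fun i _ => key i]
  simp only [hγ0]
  rw [Finset.sum_add_distrib, ← map_sum]
  set L := linForm ξ₁ ξ₂ ξ₃ 0 p
  set m : ℂ := (horo p : ℂ)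
  -- Up to factors independent of `i`, the summands here are the squares of the derivatives of
  -- `L/m`. Together with `s2` this also annihilates `∑ φᵢ''`.
  have s1 : ∑ i, (linForm ξ₁ ξ₂ ξ₃ 0 (deriv (γ i) 0) * m - L * (horo (deriv (γ i) 0) : ℂ)) ^ 2
      = 0 := by
    have : ∀ i, (linForm ξ₁ ξ₂ ξ₃ 0 (deriv (γ i) 0) * m - L * (horo (deriv (γ i) 0) : ℂ)) ^ 2 =
        m ^ 2 * linForm ξ₁ ξ₂ ξ₃ 0 (deriv (γ i) 0) ^ 2
        - 2 * L * m * (linForm ξ₁ ξ₂ ξ₃ 0 (deriv (γ i) 0) * horo (deriv (γ i) 0))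
        + L ^ 2 * (horo (deriv (γ i) 0) : ℂ) ^ 2 := fun i => by ring
    simp only [this, Finset.sum_add_distrib, Finset.sum_sub_distrib, ← Finset.mul_sum]
    rw [sLL, sLm, smm]
    ring
  have s2 : ∑ i, (horo (deriv (γ i) 0) : ℂ) *
      (linForm ξ₁ ξ₂ ξ₃ 0 (deriv (γ i) 0) * m - L * (horo (deriv (γ i) 0) : ℂ)) = 0 := by
    have : ∀ i, (horo (deriv (γ i) 0) : ℂ) *
        (linForm ξ₁ ξ₂ ξ₃ 0 (deriv (γ i) 0) * m - L * (horo (deriv (γ i) 0) : ℂ)) =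
        m * (linForm ξ₁ ξ₂ ξ₃ 0 (deriv (γ i) 0) * horo (deriv (γ i) 0))
        - L * (horo (deriv (γ i) 0) : ℂ) ^ 2 := fun i => by ring
    simp only [this, Finset.sum_sub_distrib, ← Finset.mul_sum]
    rw [sLm, smm]
    ring
  rw [sum_hessian_eq_zero hfp, zero_add]
  · rw [Finset.sum_sub_distrib]
    simp only [div_pow, ← Finset.sum_div, ← Finset.mul_sum, s1, s2]
    simp
  · simp only [div_pow, mul_pow, ← Finset.sum_div, ← Finset.mul_sum, s1]
    simp

/-! ### The fibres -/

/-- The part of `H⁴` in the kernel of `linForm ξ₁ ξ₂ ξ₃ c`: a totally geodesic surface if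
`(ξ₁, ξ₂, ξ₃)` is isotropic and nonzero. -/
def sheet (ξ₁ ξ₂ ξ₃ c : ℂ) : Set R51 := {x ∈ H4 | linForm ξ₁ ξ₂ ξ₃ c x = 0}

/-- The sheets for `c` and `-c` are disjoint: the two forms differ by `2c(x₅ - x₄)`. -/
theorem linForm_neg_ne_zero {ξ₁ ξ₂ ξ₃ c : ℂ} (hc : c ≠ 0) {x : R51} (hx : x ∈ H4)
    (h : linForm ξ₁ ξ₂ ξ₃ c x = 0) : linForm ξ₁ ξ₂ ξ₃ (-c) x ≠ 0 := by
  intro h'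
  rw [linForm_apply] at h h'
  have : 2 * c * (horo x : ℂ) = 0 := by linear_combination h' - h
  simp [hc, (horo_pos hx).ne'] at this

/-- The sheets are disjoint and relatively closed, so a continuous map into their union stays
locally on one of them. This reduces local questions on the fibre to a single linear equation. -/
theorem eventually_linForm_eq_zero {X : Type*} [TopologicalSpace X] {ξ₁ ξ₂ ξ₃ c : ℂ} (hc : c ≠ 0)
    {g : X → R51} {x : X} (hg : ContinuousAt g x)
    (hmem : ∀ᶠ y in nhds x, g y ∈ sheet ξ₁ ξ₂ ξ₃ c ∪ sheet ξ₁ ξ₂ ξ₃ (-c))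
    (h0 : linForm ξ₁ ξ₂ ξ₃ c (g x) = 0) : ∀ᶠ y in nhds x, linForm ξ₁ ξ₂ ξ₃ c (g y) = 0 := by
  have hx : g x ∈ H4 := hmem.self_of_nhds.elim (·.1) (·.1)
  have hne := ((linForm ξ₁ ξ₂ ξ₃ (-c)).continuous.continuousAt.comp hg).eventually_ne
    (linForm_neg_ne_zero hc hx h0)
  filter_upwards [hmem, hne] with y hy hy'
  exact hy.elim (·.2) fun h => absurd h.2 hy'

/-- The real solutions `x` of `ξ · x = c m` for an isotropic vector `ξ ≠ 0`. -/
theorem exists_isotropic_line {ξ₁ ξ₂ ξ₃ : ℂ} (hξ : ξ₁ ^ 2 + ξ₂ ^ 2 + ξ₃ ^ 2 = 0) (h0 : ξ₁ ≠ 0)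
    (c : ℂ) :
    ∃ y n d : Fin 3 → ℝ, ξ₁ * y 0 + ξ₂ * y 1 + ξ₃ * y 2 = c ∧
      ξ₁ * n 0 + ξ₂ * n 1 + ξ₃ * n 2 = 0 ∧
      d 0 * y 0 + d 1 * y 1 + d 2 * y 2 = 0 ∧ d 0 * n 0 + d 1 * n 1 + d 2 * n 2 = 1 ∧
      ∀ (m : ℝ) (x : Fin 3 → ℝ), ξ₁ * x 0 + ξ₂ * x 1 + ξ₃ * x 2 = c * m →
        ∀ k, x k = m * y k + (d 0 * x 0 + d 1 * x 1 + d 2 * x 2) * n k := by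
  obtain ⟨u0, v0⟩ := ξ₁
  obtain ⟨u1, v1⟩ := ξ₂
  obtain ⟨u2, v2⟩ := ξ₃
  obtain ⟨s, t⟩ := c
  have hre := congrArg Complex.re hξ
  have him := congrArg Complex.im hξ
  simp only [sq, Complex.add_re, Complex.add_im, Complex.mul_re, Complex.mul_im, Complex.zero_re,
    Complex.zero_im] at hre him
  have huv : u0 * v0 + u1 * v1 + u2 * v2 = 0 := by linarith
  obtain ⟨r, hr⟩ : ∃ r, r = u0 * u0 + u1 * u1 + u2 * u2 := ⟨_, rfl⟩
  have hr' : r = v0 * v0 + v1 * v1 + v2 * v2 := by linarith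
  have hr0 : r ≠ 0 := by
    intro hz
    apply h0
    have e1 : u0 * u0 = 0 := by
      linarith [mul_self_nonneg u0, mul_self_nonneg u1, mul_self_nonneg u2]
    have e2 : v0 * v0 = 0 := by
      linarith [mul_self_nonneg v0, mul_self_nonneg v1, mul_self_nonneg v2]
    apply Complex.ext
    · simpa using e1
    · simpa using e2
  -- Write `ξ = u + iv` and `c = s + it`. Isotropy means `u ⊥ v` and `|u|² = |v|² = r`. Then `y =
  -- (su + tv)/r` solves the equation, `n = u × v` spans the homogeneous solutions, and `d = n/r²`
  -- as `|n|² = r²`.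
  refine ⟨![(s * u0 + t * v0) / r, (s * u1 + t * v1) / r, (s * u2 + t * v2) / r],
    ![u1 * v2 - u2 * v1, u2 * v0 - u0 * v2, u0 * v1 - u1 * v0],
    ![(u1 * v2 - u2 * v1) / r ^ 2, (u2 * v0 - u0 * v2) / r ^ 2, (u0 * v1 - u1 * v0) / r ^ 2],
    ?_, ?_, ?_, ?_, ?_⟩
  · apply Complex.ext <;> simp <;> field_simp
    · linear_combination t * huv - s * hr
    · linear_combination s * huv - t * hr'
  · apply Complex.ext <;> simp <;> ring
  · simp
    field_simp
    ring
  · simp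
    field_simp
    linear_combination (-(u0 * v0 + u1 * v1 + u2 * v2)) * huv
      - (v0 * v0 + v1 * v1 + v2 * v2) * hr - r * hr'
  · intro m x hx
    have hxre := congrArg Complex.re hx
    have hxim := congrArg Complex.im hx
    simp at hxre hxim
    -- One coordinate of the expansion of `x` in `u, v, u × v`. The hypothesis is a polynomial
    -- identity for `(n·x)n` valid for arbitrary `u, v`; `a`, `p`, `q`, `nk` stand for the
    -- coordinates of `x`, `u`, `v`, `n`.
    have H : ∀ a p q nk : ℝ, nk * ((u1 * v2 - u2 * v1) * x 0 + (u2 * v0 - u0 * v2) * x 1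
        + (u0 * v1 - u1 * v0) * x 2) =
          ((u0 * u0 + u1 * u1 + u2 * u2) * (v0 * v0 + v1 * v1 + v2 * v2)
            - (u0 * v0 + u1 * v1 + u2 * v2) ^ 2) * a
          - (v0 * v0 + v1 * v1 + v2 * v2) * (u0 * x 0 + u1 * x 1 + u2 * x 2) * p
          - (u0 * u0 + u1 * u1 + u2 * u2) * (v0 * x 0 + v1 * x 1 + v2 * x 2) * q
          + (u0 * v0 + u1 * v1 + u2 * v2) * ((v0 * x 0 + v1 * x 1 + v2 * x 2) * p
            + (u0 * x 0 + u1 * x 1 + u2 * x 2) * q) →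
        a = m * ((s * p + t * q) / r) + ((u1 * v2 - u2 * v1) / r ^ 2 * x 0
          + (u2 * v0 - u0 * v2) / r ^ 2 * x 1 + (u0 * v1 - u1 * v0) / r ^ 2 * x 2) * nk := by
      intro a p q nk h
      rw [← hr, ← hr', huv, hxre, hxim] at h
      field_simp
      linear_combination -h
    intro k
    fin_cases k
    · exact H (x 0) u0 v0 (u1 * v2 - u2 * v1) (by ring)
    · exact H (x 1) u1 v1 (u2 * v0 - u0 * v2) (by ring)
    · exact H (x 2) u2 v2 (u0 * v1 - u1 * v0) (by ring)

theorem linForm_surjective {ξ₁ ξ₂ ξ₃ : ℂ} (hξ : ξ₁ ^ 2 + ξ₂ ^ 2 + ξ₃ ^ 2 = 0) (h0 : ξ₁ ≠ 0)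
    (c : ℂ) : Function.Surjective (linForm ξ₁ ξ₂ ξ₃ c) := by
  intro z
  obtain ⟨y, -, -, hy, -⟩ := exists_isotropic_line hξ h0 z
  refine ⟨![y 0, y 1, y 2, 0, 0], ?_⟩
  rw [linForm_apply, ← hy]
  simp [horo]

/-- Used to see that the position and two independent tangent vectors fill the whole kernel. -/
theorem finrank_ker_linForm {ξ₁ ξ₂ ξ₃ : ℂ} (hξ : ξ₁ ^ 2 + ξ₂ ^ 2 + ξ₃ ^ 2 = 0) (h0 : ξ₁ ≠ 0)
    (c : ℂ) : Module.finrank ℝ (linForm ξ₁ ξ₂ ξ₃ c : R51 →ₗ[ℝ] ℂ).ker = 3 := by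
  have h := LinearMap.finrank_range_add_finrank_ker (linForm ξ₁ ξ₂ ξ₃ c : R51 →ₗ[ℝ] ℂ)
  rw [LinearMap.range_eq_top.2 (linForm_surjective hξ h0 c), finrank_top,
    Complex.finrank_real_complex] at h
  simp at h
  omega

/-- Each sheet has a global parametrization, with a linear left inverse. -/
theorem exists_isLocalParam {ξ₁ ξ₂ ξ₃ c : ℂ} (hξ : ξ₁ ^ 2 + ξ₂ ^ 2 + ξ₃ ^ 2 = 0) (h0 : ξ₁ ≠ 0)
    (hc : c ≠ 0) :
    ∃ D ψ, IsLocalParam (sheet ξ₁ ξ₂ ξ₃ c ∪ sheet ξ₁ ξ₂ ξ₃ (-c)) D ψ ∧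
      ψ '' D = sheet ξ₁ ξ₂ ξ₃ c := by
  obtain ⟨y, n, d, hy, hn, hdy, hdn, hline⟩ := exists_isotropic_line hξ h0 c
  -- The coordinates are `u 1 = x₅ - x₄ > 0` and the position `u 0` on the line of solutions of `ξ·x
  -- = c(x₅ - x₄)`. The sum `q = x₄ + x₅` is then forced by `(x₅ - x₄)(x₅ + x₄) = 1 + x₁² + x₂² +
  -- x₃²`.
  set a : Fin 3 → (Fin 2 → ℝ) → ℝ := fun k u => u 1 * y k + u 0 * n k with ha
  set q : (Fin 2 → ℝ) → ℝ := fun u => (1 + a 0 u ^ 2 + a 1 u ^ 2 + a 2 u ^ 2) * (u 1)⁻¹ with hq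
  set ψ : (Fin 2 → ℝ) → R51 :=
    fun u => ![a 0 u, a 1 u, a 2 u, (q u - u 1) / 2, (q u + u 1) / 2] with hψ
  set D : Set (Fin 2 → ℝ) := {u | 0 < u 1} with hD
  set Λ : R51 → Fin 2 → ℝ := fun x => ![d 0 * x 0 + d 1 * x 1 + d 2 * x 2, x 4 - x 3] with hΛ
  have hDo : IsOpen D := isOpen_lt continuous_const (continuous_apply 1)
  have hΛs : ContDiff ℝ ∞ Λ := by
    rw [contDiff_pi]
    intro i
    fin_cases i <;> simp [hΛ] <;> fun_prop
  have hψs : ContDiffOn ℝ ∞ ψ D := by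
    have hqs : ContDiffOn ℝ ∞ q D := by
      apply ContDiffOn.mul
      · exact ContDiff.contDiffOn (by simp only [ha]; fun_prop)
      · exact ContDiffOn.inv (by fun_prop) fun u hu => ne_of_gt hu
    rw [contDiffOn_pi]
    intro i
    fin_cases i
    · exact ContDiff.contDiffOn (by simp [hψ, ha]; fun_prop)
    · exact ContDiff.contDiffOn (by simp [hψ, ha]; fun_prop)
    · exact ContDiff.contDiffOn (by simp [hψ, ha]; fun_prop)
    · exact (hqs.sub (by fun_prop)).div_const 2
    · exact (hqs.add (by fun_prop)).div_const 2
  have hΛψ : ∀ u, Λ (ψ u) = u := by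
    intro u
    funext i
    fin_cases i
    · simp [hΛ, hψ, ha]
      linear_combination u 1 * hdy + u 0 * hdn
    · simp [hΛ, hψ]
      ring
  have himg : ψ '' D = sheet ξ₁ ξ₂ ξ₃ c := by
    ext x
    constructor
    · rintro ⟨u, hu, rfl⟩
      have hu : 0 < u 1 := hu
      refine ⟨⟨?_, ?_⟩, ?_⟩
      · simp [lor, hψ, hq]
        field_simp
        ring
      · simp [hψ, hq]
        positivity
      · rw [linForm_apply]
        have : (horo (ψ u) : ℂ) = u 1 := by
          congr 1
          simp [horo, hψ]
          ring
        rw [this]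
        simp [hψ, ha]
        linear_combination (u 1 : ℂ) * hy + (u 0 : ℂ) * hn
    · rintro ⟨hx, hx0⟩
      have hpos := horo_pos hx
      refine ⟨Λ x, ?_, ?_⟩
      · simpa [hD, hΛ, horo] using hpos
      · have hl := hline (horo x) (fun k => x ⟨k, by omega⟩) (by
          rw [linForm_apply] at hx0
          exact sub_eq_zero.1 hx0)
        have ha' : ∀ k : Fin 3, a k (Λ x) = x ⟨k, by omega⟩ := fun k => (hl k).symm
        have hqx : q (Λ x) = x 4 + x 3 := by
          have h1 := hx.1
          simp only [lor] at h1
          have e0 : a 0 (Λ x) = x 0 := ha' 0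
          have e1 : a 1 (Λ x) = x 1 := ha' 1
          have e2 : a 2 (Λ x) = x 2 := ha' 2
          have e : Λ x 1 = x 4 - x 3 := rfl
          simp only [hq, e0, e1, e2, e]
          rw [← div_eq_mul_inv, div_eq_iff (show x 4 - x 3 ≠ 0 from ne_of_gt hpos)]
          linarith
        funext i
        fin_cases i
        · exact ha' 0
        · exact ha' 1
        · exact ha' 2
        · change (q (Λ x) - (x 4 - x 3)) / 2 = x 3
          rw [hqx]; ring
        · change (q (Λ x) + (x 4 - x 3)) / 2 = x 4
          rw [hqx]; ring
  refine ⟨D, ψ, ⟨hDo, hψs, ?_, ?_, ?_⟩, himg⟩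
  · intro u hu
    have h1 : HasFDerivAt (Λ ∘ ψ) ((fderiv ℝ Λ (ψ u)).comp (fderiv ℝ ψ u)) u :=
      (hΛs.differentiable (by simp) _).hasFDerivAt.comp u
        ((hψs.contDiffAt (hDo.mem_nhds hu)).differentiableAt (by simp)).hasFDerivAt
    have h2 : (Λ ∘ ψ) = id := funext hΛψ
    rw [h2] at h1
    have h3 := h1.unique (hasFDerivAt_id u)
    exact Function.LeftInverse.injective (g := fderiv ℝ Λ (ψ u)) fun w =>
      congrArg (fun l => l w) h3
  · have : Function.LeftInverse (fun x : ψ '' D => (⟨Λ x, by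
        obtain ⟨u, hu, h⟩ := x.2
        rw [← h, hΛψ]; exact hu⟩ : D)) (fun u : D => (⟨ψ u, u, u.2, rfl⟩ : ψ '' D)) :=
      fun u => Subtype.ext (hΛψ u)
    exact Topology.IsEmbedding.subtypeVal.comp (this.isEmbedding
      ((hΛs.continuous.comp continuous_subtype_val).subtype_mk _)
      (hψs.continuousOn.domRestrict.subtype_mk _))
  · refine ⟨{x | linForm ξ₁ ξ₂ ξ₃ (-c) x ≠ 0},
      isOpen_ne_fun (linForm ξ₁ ξ₂ ξ₃ (-c)).continuous continuous_const, ?_⟩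
    rw [himg]
    ext x
    constructor
    · exact fun h => ⟨Or.inl h, linForm_neg_ne_zero hc h.1 h.2⟩
    · rintro ⟨h | h, h'⟩
      · exact h
      · exact absurd h.2 h'

theorem isEmbeddedSurface_sheets {ξ₁ ξ₂ ξ₃ c : ℂ} (hξ : ξ₁ ^ 2 + ξ₂ ^ 2 + ξ₃ ^ 2 = 0)
    (h0 : ξ₁ ≠ 0) (hc : c ≠ 0) :
    IsEmbeddedSurface (sheet ξ₁ ξ₂ ξ₃ c ∪ sheet ξ₁ ξ₂ ξ₃ (-c)) := by
  rintro p (hp | hp)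
  · obtain ⟨D, ψ, h, hi⟩ := exists_isLocalParam hξ h0 hc
    exact ⟨D, ψ, h, hi ▸ hp⟩
  · obtain ⟨D, ψ, h, hi⟩ := exists_isLocalParam hξ h0 (neg_ne_zero.2 hc)
    rw [neg_neg, Set.union_comm] at h
    exact ⟨D, ψ, h, hi ▸ hp⟩

/-! ### Vanishing of the mean curvature -/

theorem ContinuousLinearMap.apply_fderiv_eq_zero {E F G : Type*} [NormedAddCommGroup E]
    [NormedSpace ℝ E] [NormedAddCommGroup F] [NormedSpace ℝ F] [NormedAddCommGroup G]
    [NormedSpace ℝ G] (l : F →L[ℝ] G) {g : E → F} {u : E} (hg : DifferentiableAt ℝ g u)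
    (h : ∀ᶠ w in nhds u, l (g w) = 0) (e : E) : l (fderiv ℝ g u e) = 0 := by
  have h1 := (l.hasFDerivAt.comp u hg.hasFDerivAt).unique
    ((hasFDerivAt_const (0 : G) u).congr_of_eventuallyEq h)
  exact congrArg (fun l => l e) h1

/-- The linear form `x ↦ ⟨x, ν⟩`. -/
def lorLeft (ν : R51) : R51 →ₗ[ℝ] ℝ where
  toFun x := lor x ν
  map_add' x y := lor_add_left x y ν
  map_smul' r x := lor_smul_left r x ν

theorem lor_fderiv_eq_zero {ψ : (Fin 2 → ℝ) → R51} {u : Fin 2 → ℝ} (hψ : DifferentiableAt ℝ ψ u)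
    (hmem : ∀ᶠ w in nhds u, ψ w ∈ H4) (e : Fin 2 → ℝ) : lor (ψ u) (fderiv ℝ ψ u e) = 0 := by
  have hline : HasDerivAt (fun t : ℝ => u + t • e) e 0 := by
    simpa using ((hasDerivAt_id (0 : ℝ)).smul_const e).const_add u
  have hu : u + (0 : ℝ) • e = u := by simp
  have h1 : HasDerivAt (fun t : ℝ => ψ (u + t • e)) (fderiv ℝ ψ u e) 0 :=
    HasFDerivAt.comp_hasDerivAt (f := fun t : ℝ => u + t • e) 0
      (by simpa only [hu] using hψ.hasFDerivAt) hline
  have h2 := lor_deriv_eq_zero h1.differentiableAt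
    (hline.continuousAt.eventually (by simpa only [hu] using hmem))
  rwa [h1.deriv, hu] at h2

/-- The sheets are totally geodesic: the second derivatives of a local parametrization stay in the
three-dimensional linear space spanned by the position and the tangent vectors. -/
theorem meanCurvatureVanishesAt_of_linForm_eq_zero {ξ₁ ξ₂ ξ₃ c : ℂ}
    (hξ : ξ₁ ^ 2 + ξ₂ ^ 2 + ξ₃ ^ 2 = 0) (h0 : ξ₁ ≠ 0) (hc : c ≠ 0) {D : Set (Fin 2 → ℝ)}
    {ψ : (Fin 2 → ℝ) → R51} (hψ : IsLocalParam (sheet ξ₁ ξ₂ ξ₃ c ∪ sheet ξ₁ ξ₂ ξ₃ (-c)) D ψ)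
    {u : Fin 2 → ℝ} (hu : u ∈ D) (hu0 : linForm ξ₁ ξ₂ ξ₃ c (ψ u) = 0) :
    MeanCurvatureVanishesAt ψ u := by
  intro ν hν hνk
  obtain ⟨V, -, hV⟩ := hψ.image
  have hS : ∀ w ∈ D, ψ w ∈ sheet ξ₁ ξ₂ ξ₃ c ∪ sheet ξ₁ ξ₂ ξ₃ (-c) := fun w hw =>
    (hV.subset ⟨w, hw, rfl⟩).1
  have hDev : ∀ᶠ w in nhds u, w ∈ D := hψ.isOpen.mem_nhds hu
  have hsm : ∀ w ∈ D, ContDiffAt ℝ ∞ ψ w := fun w hw =>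
    hψ.smooth.contDiffAt (hψ.isOpen.mem_nhds hw)
  have hev := eventually_linForm_eq_zero hc (hsm u hu).continuousAt (hDev.mono hS) hu0
  have hpd : ∀ j, ∀ᶠ w in nhds u, linForm ξ₁ ξ₂ ξ₃ c (pd ψ j w) = 0 := by
    intro j
    filter_upwards [hev.eventually_nhds, hDev] with w hw hwD
    exact (linForm ξ₁ ξ₂ ξ₃ c).apply_fderiv_eq_zero ((hsm w hwD).differentiableAt (by simp)) hw _
  have hpdd : ∀ j, DifferentiableAt ℝ (pd ψ j) u := fun j =>
    (((hsm u hu).fderiv_right (m := 1) (by norm_cast)).differentiableAt (by simp)).clm_apply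
      (differentiableAt_const _)
  have hpd2 : ∀ i j, linForm ξ₁ ξ₂ ξ₃ c (pd (pd ψ j) i u) = 0 := fun i j =>
    (linForm ξ₁ ξ₂ ξ₃ c).apply_fderiv_eq_zero (hpdd j) (hpd j) _
  have hH : ∀ w ∈ D, ψ w ∈ H4 := fun w hw => (hS w hw).elim (·.1) (·.1)
  have horth : ∀ k, lor (ψ u) (pd ψ k u) = 0 := fun k =>
    lor_fderiv_eq_zero ((hsm u hu).differentiableAt (by simp)) (hDev.mono hH) _
  -- Pairing a relation with `ψ u`, which is timelike and orthogonal to the tangent vectors, removes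
  -- its coefficient; the immersion property handles the other two.
  have hli : LinearIndependent ℝ ![ψ u, pd ψ 0 u, pd ψ 1 u] := by
    rw [Fintype.linearIndependent_iff]
    intro g hg
    simp only [Fin.sum_univ_three, Matrix.cons_val] at hg
    have hg0 : g 0 = 0 := by
      have := congrArg (lorLeft (ψ u)) hg
      simp only [map_add, map_smul, map_zero] at this
      simp only [lorLeft, LinearMap.coe_mk, AddHom.coe_mk, smul_eq_mul, (hH u hu).1,
        lor_comm _ (ψ u), horth] at this
      linarith
    have hz : fderiv ℝ ψ u (g 1 • Pi.single 0 1 + g 2 • Pi.single 1 1) = 0 := by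
      rw [hg0, zero_smul, zero_add] at hg
      rw [map_add, map_smul, map_smul]
      exact hg
    have hz' := hψ.immersion u hu (hz.trans (map_zero _).symm)
    have z1 := congrFun hz' 0
    have z2 := congrFun hz' 1
    simp at z1 z2
    intro i
    fin_cases i
    exacts [hg0, z1, z2]
  set K := (linForm ξ₁ ξ₂ ξ₃ c : R51 →ₗ[ℝ] ℂ).ker
  let b : Fin 3 → K := ![⟨ψ u, hu0⟩, ⟨pd ψ 0 u, (hpd 0).self_of_nhds⟩,
    ⟨pd ψ 1 u, (hpd 1).self_of_nhds⟩]
  have hb : LinearIndependent ℝ b := by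
    apply LinearIndependent.of_comp K.subtype
    convert hli using 1
    funext i
    fin_cases i <;> rfl
  have hspan := hb.span_eq_top_of_card_eq_finrank
    (by rw [finrank_ker_linForm hξ h0 c, Fintype.card_fin])
  -- `⟨·,ν⟩` vanishes on a basis of the kernel, which contains all second derivatives; so the whole
  -- second fundamental form vanishes, not only its trace.
  have hzero : (lorLeft ν).comp K.subtype = 0 := by
    refine LinearMap.ext_on_range hspan fun i => ?_
    fin_cases i
    exacts [hν, hνk 0, hνk 1]
  have hall : ∀ i j, lor (pd (pd ψ j) i u) ν = 0 := fun i j =>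
    congrArg (fun l => l ⟨pd (pd ψ j) i u, hpd2 i j⟩) hzero
  simp [hall]

theorem isMinimalSurfaceH4_sheets {ξ₁ ξ₂ ξ₃ c : ℂ} (hξ : ξ₁ ^ 2 + ξ₂ ^ 2 + ξ₃ ^ 2 = 0)
    (h0 : ξ₁ ≠ 0) (hc : c ≠ 0) (hne : (sheet ξ₁ ξ₂ ξ₃ c ∪ sheet ξ₁ ξ₂ ξ₃ (-c)).Nonempty) :
    IsMinimalSurfaceH4 (sheet ξ₁ ξ₂ ξ₃ c ∪ sheet ξ₁ ξ₂ ξ₃ (-c)) where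
  nonempty := hne
  subset := fun x hx => hx.elim (·.1) (·.1)
  embedded := isEmbeddedSurface_sheets hξ h0 hc
  minimal := by
    intro D ψ hψ u hu
    obtain ⟨V, -, hV⟩ := hψ.image
    rcases (hV.subset ⟨u, hu, rfl⟩).1 with h | h
    · exact meanCurvatureVanishesAt_of_linForm_eq_zero hξ h0 hc hψ hu h.2
    · refine meanCurvatureVanishesAt_of_linForm_eq_zero hξ h0 (neg_ne_zero.2 hc) ?_ hu h.2
      rwa [neg_neg, Set.union_comm]

/-! ### Completeness of the fibres -/

/-- A sheet contains the geodesics of `H⁴` that are tangent to it. -/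
theorem exists_isGeodesic_of_linForm_eq_zero {ξ₁ ξ₂ ξ₃ c : ℂ} {S : Set R51} (hS : S ⊆ H4)
    (hcS : sheet ξ₁ ξ₂ ξ₃ c ⊆ S) {p v : R51} (hp : p ∈ sheet ξ₁ ξ₂ ξ₃ c) (hpv : lor p v = 0)
    (hv : linForm ξ₁ ξ₂ ξ₃ c v = 0) :
    ∃ γ : ℝ → R51, IsGeodesic S γ ∧ γ 0 = p ∧ deriv γ 0 = v := by
  by_cases hv0 : v = 0
  · refine ⟨fun _ => p, ⟨contDiff_const, fun _ => hcS hp, fun t w _ => ?_⟩, rfl, ?_⟩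
    · simp [lor_zero_left]
    · simp [hv0]
  have hpos := lor_self_pos hp.1 hpv hv0
  -- The explicit geodesics have unit speed; running one at speed `s` gives initial velocity `v`.
  set s := √(lor v v) with hs
  have hs0 : s ≠ 0 := (Real.sqrt_pos.2 hpos).ne'
  have hss : s ^ 2 = lor v v := Real.sq_sqrt hpos.le
  obtain ⟨hg, hd⟩ := isGeodesic_H4 hp.1 (v := s⁻¹ • v)
    (by rw [lor_smul_right, hpv, mul_zero])
    (by
      rw [lor_smul_right, lor_smul_left, ← hss]
      field_simp)
  set g : ℝ → R51 := fun t => Real.cosh t • p + Real.sinh t • s⁻¹ • v with hgdef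
  have hmem : ∀ t, g t ∈ sheet ξ₁ ξ₂ ξ₃ c := fun t => ⟨hg.mem t, by
    simp only [hgdef, map_add, map_smul, hp.2, hv, smul_zero, add_zero]⟩
  have hd1 : deriv (fun t => g (s * t)) = fun t => s • deriv g (s * t) :=
    funext fun t => deriv_comp_mul_left s g t
  have hd2 : ∀ t, deriv (deriv fun t => g (s * t)) t = s • s • deriv (deriv g) (s * t) := by
    intro t
    have hdiff : DifferentiableAt ℝ (fun t => deriv g (s * t)) t :=
      ((contDiff_infty_iff_deriv.1 hg.smooth).2.comp
        (contDiff_const.mul contDiff_id)).differentiable (by simp) t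
    rw [hd1, deriv_fun_const_smul _ hdiff, deriv_comp_mul_left s (deriv g) t]
  refine ⟨fun t => g (s * t), ⟨hg.smooth.comp (contDiff_const.mul contDiff_id),
    fun t => hcS (hmem _), ?_⟩, ?_, ?_⟩
  -- Tangent vectors of `S` are tangent to `H⁴`, so a geodesic of `H⁴` lying in `S` is a geodesic of
  -- `S`.
  · rintro t w ⟨k, hk, hk0, hkS, rfl⟩
    rw [hd2, lor_smul_left, lor_smul_left,
      hg.acceleration _ _ ⟨k, hk, hk0, hkS.mono fun _ h => hS h, rfl⟩]
    simp
  · simp [hgdef]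
  · rw [hd1]
    simp only [mul_zero, hd]
    rw [smul_smul, mul_inv_cancel₀ hs0, one_smul]

/-- A curve in the union stays near `t = 0` on the sheet of its starting point, so its velocity is
annihilated by the linear form of that sheet. -/
theorem isCompleteSubmanifold_sheets {ξ₁ ξ₂ ξ₃ c : ℂ} (hc : c ≠ 0) :
    IsCompleteSubmanifold (sheet ξ₁ ξ₂ ξ₃ c ∪ sheet ξ₁ ξ₂ ξ₃ (-c)) := by
  rintro p hp v ⟨k, hk, rfl, hkS, rfl⟩
  have hdiff : DifferentiableAt ℝ k 0 := hk.differentiable (by simp) 0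
  have hsub : ∀ x ∈ sheet ξ₁ ξ₂ ξ₃ c ∪ sheet ξ₁ ξ₂ ξ₃ (-c), x ∈ H4 := fun x hx =>
    hx.elim (·.1) (·.1)
  have hpv := lor_deriv_eq_zero hdiff (hkS.mono fun _ h => hsub _ h)
  rcases hp with hp | hp
  · exact exists_isGeodesic_of_linForm_eq_zero hsub Set.subset_union_left hp hpv
      ((linForm ξ₁ ξ₂ ξ₃ c).apply_fderiv_eq_zero hdiff
        (eventually_linForm_eq_zero hc hdiff.continuousAt hkS hp.2) 1)
  · exact exists_isGeodesic_of_linForm_eq_zero hsub Set.subset_union_right hp hpv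
      ((linForm ξ₁ ξ₂ ξ₃ (-c)).apply_fderiv_eq_zero hdiff
        (eventually_linForm_eq_zero (neg_ne_zero.2 hc) hdiff.continuousAt
          (by rwa [neg_neg, Set.union_comm]) hp.2) 1)

theorem fibre_eq_sheets {a₁ a₂ b₁ b₂ b₃ : ℂ} (h₁ : a₁ ^ 2 + b₁ ^ 2 + b₂ ^ 2 = 0)
    (h₂ : a₁ * a₂ = -b₂ ^ 2) (h₃ : a₁ * b₃ = b₁ * b₂) (ha : a₁ ≠ 0) {α c : ℂ}
    (hc : c ^ 2 = a₁ * α) :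
    {x ∈ H4 | quadP a₁ a₂ b₁ b₂ b₃ x = α * quadQ x} =
      sheet a₁ b₁ b₂ c ∪ sheet a₁ b₁ b₂ (-c) := by
  ext x
  have key : quadP a₁ a₂ b₁ b₂ b₃ x = α * quadQ x ↔
      linForm a₁ b₁ b₂ c x * linForm a₁ b₁ b₂ (-c) x = 0 := by
    rw [← mul_right_inj' ha, mul_quadP h₁ h₂ h₃, quadQ_eq_horo_sq, ← mul_assoc, ← hc,
      ← sub_eq_zero]
    simp only [linForm_apply]
    ring_nf
  simp only [Set.mem_ofPred_eq, key, mul_eq_zero, sheet, Set.mem_union]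
  tauto

theorem mainTheorem2 (a₁ a₂ b₁ b₂ b₃ : ℂ)
    (h₁ : a₁ ^ 2 + b₁ ^ 2 + b₂ ^ 2 = 0) (h₂ : a₁ * a₂ = -b₂ ^ 2) (h₃ : a₁ * b₃ = b₁ * b₂)
    (h₀ : a₁ * b₁ * b₂ ≠ 0) :
    (∀ x ∈ H4, quadQ x ≠ 0) ∧
    IsHarmonicMorphismH4 (fun x => quadP a₁ a₂ b₁ b₂ b₃ x / quadQ x) ∧
    ∀ α : ℂ, α ≠ 0 → α ∈ (fun x => quadP a₁ a₂ b₁ b₂ b₃ x / quadQ x) '' H4 →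
      {x ∈ H4 | quadP a₁ a₂ b₁ b₂ b₃ x / quadQ x = α} =
        {x ∈ H4 | quadP a₁ a₂ b₁ b₂ b₃ x = α * quadQ x} ∧
      IsMinimalSurfaceH4 {x ∈ H4 | quadP a₁ a₂ b₁ b₂ b₃ x = α * quadQ x} ∧
      IsCompleteSubmanifold {x ∈ H4 | quadP a₁ a₂ b₁ b₂ b₃ x = α * quadQ x} := by
  have ha : a₁ ≠ 0 := left_ne_zero_of_mul (left_ne_zero_of_mul h₀)
  refine ⟨fun x hx => quadQ_ne_zero hx, ?_, ?_⟩
  · simp only [quadP_div_quadQ h₁ h₂ h₃ ha]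
    exact isHarmonicMorphismH4_sq_div h₁ a₁
  rintro α hα ⟨x, hx, hxα⟩
  -- A square root of `a₁α` splits the fibre into sheets; it is nonzero because `α ≠ 0`, which keeps
  -- them disjoint.
  obtain ⟨c, hc⟩ := IsAlgClosed.exists_pow_nat_eq (a₁ * α) two_pos
  have hc0 : c ≠ 0 := by
    rintro rfl
    exact mul_ne_zero ha hα (by simpa using hc.symm)
  have hne : {x ∈ H4 | quadP a₁ a₂ b₁ b₂ b₃ x = α * quadQ x}.Nonempty :=
    ⟨x, hx, (div_eq_iff (quadQ_ne_zero hx)).1 hxα⟩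
  refine ⟨?_, ?_, ?_⟩
  · ext y
    exact and_congr_right fun hy => div_eq_iff (quadQ_ne_zero hy)
  · rw [fibre_eq_sheets h₁ h₂ h₃ ha hc] at hne ⊢
    exact isMinimalSurfaceH4_sheets h₁ ha hc0 hne
  · rw [fibre_eq_sheets h₁ h₂ h₃ ha hc]
    exact isCompleteSubmanifold_sheets hc0
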